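/- **Setting.** Let $N=2S-1$ be odd ($S\ge 1$) and let $M\ge 1$ be the number of pieces. For $T>0$ and $d=(d_{start},d_{end})\in\mathbb R^{2S\times 3}$ let $p_{d,T}:\mathbb R\to\mathbb R^3$ be the unique polynomial of degree at most $N$ with $(p(0),\dots,p^{(S-1)}(0))=d_{start}$ and $(p(T),\dots,p^{(S-1)}(T))=d_{end}$. An $M$-piece trajectory is given by durations $\mathbf T=(T_1,\dots,T_M)\in(0,\infty)^M$ and boundary data $\mathbf D=(d_1,\dots,d_{M+1})$ with $d_m\in\mathbb R^{S\times 3}$; its $m$-th piece is $p_{\mathbf d_m,T_m}$ with $\mathbf d_m=(d_m,d_{m+1})$. Some entries of $\mathbf D$, collected in $\mathbf D_F$, are fixed; the other, free entries form $\mathbf D_P$. For real weights $\rho$ and $w_i$ and orders $D_{min},D_{max}\in\mathbb N$ put $$J(\mathbf D_P,\mathbf T)=\sum_{m=1}^{M}\int_0^{T_m}\Big(\rho+\sum_{i=D_{min}}^{D_{max}}w_i\big\|p_{\mathbf d_m,T_m}^{(i)}(t)\big\|^2\Big)\,dt .$$ **Algorithm (alternating minimization).** Given $\mathbf D_P^0$,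 let $\mathbf T^0\in\operatorname{argmin}_{\mathbf T\in(0,\infty)^M}J(\mathbf D_P^0,\mathbf T)$ and, for $k=0,1,2,\dots$, $\mathbf D_P^{k+1}\in\operatorname{argmin}_{\mathbf D_P}J(\mathbf D_P,\mathbf T^k)$ and $\mathbf T^{k+1}\in\operatorname{argmin}_{\mathbf T\in(0,\infty)^M}J(\mathbf D_P^{k+1},\mathbf T)$. **Theorem.** Suppose that the iterates $(\mathbf D_P^k,\mathbf T^k)$ converge to a strict local minimum $(\widehat{\mathbf D}_P,\widehat{\mathbf T})$ of $J$, where $\widehat{\mathbf T}\in(0,\infty)^M$, and let $J^*=J(\widehat{\mathbf D}_P,\widehat{\mathbf T})$. Then there are a positive integer $K_c$ and a real $\gamma>0$ such that for all integers $K\ge K_c$ $$J(\mathbf D_P^K,\mathbf T^K)-J^*\le\frac{1}{\gamma(K-K_c)+\big(J(\mathbf D_P^{K_c},\mathbf T^{K_c})-J^*\big)^{-1}},$$ where, if $J(\mathbf D_P^{K_c},\mathbf T^{K_c})=J^*$, the right-hand side is read as $0$ and moreover $J(\mathbf D_P^K,\mathbf T^K)=J^*$ for all $K\ge K_c$. In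 particular $J(\mathbf D_P^K,\mathbf T^K)-J^*=O(1/K)$. -/

import Mathlib

open Filter Topology

noncomputable section

namespace TrajAM

open Polynomial

/-- Index set of the `N + 1 = 2 S` coefficients of a polynomial of odd order `N = 2 S - 1`, and also
of its `2 S` boundary data: `inl` is the start point, `inr` the end point of the piece. -/
abbrev Idx (S : ℕ) : Type := Fin S ⊕ Fin S

/-- The exponent of the basis monomial with index `c`: `0, …, S - 1` and then `S, …, 2 S - 1`. -/
def expo {S : ℕ} : Idx S → ℕ
  | Sum.inl j => (j : ℕ)
  | Sum.inr j => S + (j : ℕ)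

/-- The mapping matrix `A(T)`, which sends the coefficients of a polynomial `p` of order `2 S - 1` to
`(p(0), …, p^{(S-1)}(0), p(T), …, p^{(S-1)}(T))`. It is non-singular for `T ≠ 0`. -/
def mapMat (S : ℕ) (T : ℝ) : Matrix (Idx S) (Idx S) ℝ :=
  Matrix.of fun r c =>
    match r with
    | Sum.inl i => (derivative^[(i : ℕ)] (X ^ expo c : ℝ[X])).eval 0
    | Sum.inr i => (derivative^[(i : ℕ)] (X ^ expo c : ℝ[X])).eval T

/-- Coordinate `a` of the polynomial piece with duration `T` and boundary condition `d`: the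
polynomial with coefficient matrix `A(T)⁻¹ d`. -/
def piecePoly {S : ℕ} (d : Matrix (Idx S) (Fin 3) ℝ) (T : ℝ) (a : Fin 3) : ℝ[X] :=
  ∑ c : Idx S, C (((mapMat S T)⁻¹ * d) c a) * X ^ expo c

/-- Parameters of the planning objective. -/
structure Weights where
  /-- weight of the time regularization -/
  rho : ℝ
  /-- lowest order of derivative that is penalized -/
  Dmin : ℕ
  /-- highest order of derivative that is penalized -/
  Dmax : ℕ
  /-- weight of the derivative of each order -/
  w : ℕ → ℝ

/-- The cost `∫₀ᵀ (ρ + ∑ᵢ wᵢ ‖p⁽ⁱ⁾(t)‖²) dt` of one piece `p`. -/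
def pieceCost {S : ℕ} (W : Weights) (d : Matrix (Idx S) (Fin 3) ℝ) (T : ℝ) : ℝ :=
  ∫ t in (0 : ℝ)..T,
    (W.rho + ∑ i ∈ Finset.Icc W.Dmin W.Dmax,
      W.w i * ∑ a : Fin 3, ((derivative^[i] (piecePoly d T a)).eval t) ^ 2)

/-- The entries of `D = (d₁, …, d_{M+1})`: node, order of derivative, spatial coordinate. -/
abbrev Entry (S M : ℕ) : Type := Fin (M + 1) × Fin S × Fin 3

/-- The boundary data `D` assembled from its fixed part `D_F` and its free part `D_P`; `F` is the set
of free entries. -/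
def assemble {S M : ℕ} (F : Finset (Entry S M)) (DF : {e // e ∉ F} → ℝ) (DP : {e // e ∈ F} → ℝ) :
    Entry S M → ℝ :=
  fun e => if h : e ∈ F then DP ⟨e, h⟩ else DF ⟨e, h⟩

/-- The boundary condition of the `m`-th piece, made of the data at nodes `m` and `m + 1`. -/
def boundary {S M : ℕ} (D : Entry S M → ℝ) (m : Fin M) : Matrix (Idx S) (Fin 3) ℝ :=
  Matrix.of fun r a =>
    match r with
    | Sum.inl i => D (m.castSucc, i, a)
    | Sum.inr i => D (m.succ, i, a)

/-- The objective `J(D_P, T)`: the time integral of `ρ + ∑ᵢ wᵢ ‖P⁽ⁱ⁾‖²` over the whole piecewise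
polynomial trajectory `P`, that is, the sum over the pieces of the integral over each piece. -/
def cost {S M : ℕ} (W : Weights) (F : Finset (Entry S M)) (DF : {e // e ∉ F} → ℝ)
    (DP : {e // e ∈ F} → ℝ) (T : Fin M → ℝ) : ℝ :=
  ∑ m : Fin M, pieceCost W (boundary (assemble F DF DP) m) (T m)

/-- The admissible time allocations: all durations are positive. -/
def posTimes (M : ℕ) : Set (Fin M → ℝ) := {T | ∀ m, 0 < T m}

/-- `T` is a global minimizer of `f` over the positive time allocations. -/
def IsArgminTime {M : ℕ} (f : (Fin M → ℝ) → ℝ) (T : Fin M → ℝ) : Prop :=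
  T ∈ posTimes M ∧ IsMinOn f (posTimes M) T

/-- `(D_P^k, T^k)`, `k = 0, 1, 2, …`, are iterates of alternating minimization of `J`, started at
`D_P^0`. Where a minimizer is not unique, any choice is allowed. -/
structure IsAMRun {ι : Type} {M : ℕ} (J : (ι → ℝ) → (Fin M → ℝ) → ℝ)
    (DP : ℕ → ι → ℝ) (T : ℕ → Fin M → ℝ) : Prop where
  init : IsArgminTime (J (DP 0)) (T 0)
  stepD : ∀ k, IsMinOn (fun D => J D (T k)) Set.univ (DP (k + 1))
  stepT : ∀ k, IsArgminTime (J (DP (k + 1))) (T (k + 1))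

/-- `(D, T)` is a strict local minimum of `J` on the domain of positive time allocations. -/
def IsStrictLocalMin {ι : Type} {M : ℕ} (J : (ι → ℝ) → (Fin M → ℝ) → ℝ)
    (D : ι → ℝ) (T : Fin M → ℝ) : Prop :=
  T ∈ posTimes M ∧ ∀ᶠ y in 𝓝 (D, T), y ≠ (D, T) → J D T < J y.1 y.2

end TrajAM

end

/-! Let δ_k be the gap J(D^k, T^k) - J*. It suffices that δ_k² ≤ C (δ_k - δ_{k+1}) for all large k
(`IsAMRun.exists_sq_le`): then 1/δ_k grows at least linearly (`le_one_div_of_succ_le_sub_sq`). Local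
minimality enters only through δ_k ≥ 0 for large k.

Two facts about J near the limit give this recursion. Both rest on J being a rational function of
(D_P, T) without poles at positive times (`isRatOn_cost`). A full sweep lowers J at least as much as
any move of a single coordinate, so every partial derivative at the k-th iterate is O(√(δ_k -
δ_{k+1})) (`exists_sq_quotDeriv_le`). And |J - J*| ≤ C ∑ |∂_i J| near the limit
(`eventually_abs_quot_sub_le`), a Łojasiewicz inequality in which the exponent 1 is enough.

The Łojasiewicz inequality is proved algebraically. Let f be a complex polynomial with f(a) = 0, m
the maximal ideal of a and I = (f, ∂_1 f, …). Then f^N ∈ m I^N for some N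
(`exists_pow_mem_ker_eval_mul_pow`), and evaluation near a gives |f|^N = o((|f| + ∑ |∂_i f|)^N). If
there were no such N, the chart R[∂_i f / f] of the blow-up of I would have a point over a. Through
that point passes a formal curve on which f is not identically zero (`HasArc.of_finiteType`), and
along it f divides every ∂_i f. In characteristic 0 this is impossible: differentiating f along a
curve lowers its order by exactly one (`exists_not_dvd_aeval_pderiv`). -/

namespace TrajAM

open Polynomial

-- Formal curves through a point of an affine variety

universe u

/-- `V` is a discrete valuation ring with residue field `k` that receives `A` in such a way that the
ideal `P` goes to the maximal ideal and `f` does not vanish: a formal curve on `A`, centred at `P`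
and not contained in the zero set of `f`. -/
def HasArc (k : Type*) [Field k] {A : Type u} [CommRing A] [Algebra k A] (P : Ideal A) (f : A) :
    Prop :=
  ∃ (V : Type u) (_ : CommRing V) (_ : IsDomain V) (_ : IsDiscreteValuationRing V)
    (_ : Algebra k V) (φ : A →ₐ[k] V), φ f ≠ 0 ∧
      (∀ x ∈ P, φ x ∈ IsLocalRing.maximalIdeal V) ∧
      ∀ v : V, ∃ c : k, v - algebraMap k V c ∈ IsLocalRing.maximalIdeal V

theorem HasArc.of_algHom {k : Type*} [Field k] {A B : Type u} [CommRing A] [Algebra k A]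
    [CommRing B] [Algebra k B] {P : Ideal A} {f : A} {P' : Ideal B} (ψ : A →ₐ[k] B)
    (hP : P ≤ P'.comap ψ) (h : HasArc k P' (ψ f)) : HasArc k P f := by
  obtain ⟨V, i1, i2, i3, i4, φ, h1, h2, h3⟩ := h
  exact ⟨V, i1, i2, i3, i4, φ.comp ψ, h1, fun x hx => h2 _ (hP hx), h3⟩

/-- Nullstellensatz: the residue field at a maximal ideal is finite over `k`, hence equal to `k`. -/
theorem exists_sub_algebraMap_mem {k A : Type*} [Field k] [IsAlgClosed k] [CommRing A]
    [Algebra k A] [Algebra.FiniteType k A] (P : Ideal A) [P.IsMaximal] (a : A) :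
    ∃ c : k, a - algebraMap k A c ∈ P := by
  let := Ideal.Quotient.field P
  have : Module.Finite k (A ⧸ P) := finite_of_finite_type_of_isJacobsonRing k (A ⧸ P)
  obtain ⟨c, hc⟩ := (IsAlgClosed.algebraMap_bijective_of_isIntegral (k := k) (K := A ⧸ P)).2
    (Ideal.Quotient.mk P a)
  refine ⟨c, ?_⟩
  rw [← Ideal.Quotient.eq_zero_iff_mem, map_sub, ← hc]
  exact sub_eq_zero.2 (IsScalarTower.algebraMap_apply k A (A ⧸ P) c)

/-- On a smooth curve the local ring at the point is itself the required valuation ring. -/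
theorem HasArc.of_isDedekindDomain {k : Type*} {C : Type u} [Field k] [IsAlgClosed k] [CommRing C]
    [IsDedekindDomain C] [Algebra k C] [Algebra.FiniteType k C] (P : Ideal C) [P.IsMaximal]
    {f : C} (hf : f ≠ 0) (hfP : f ∈ P) : HasArc k P f := by
  have hP : P ≠ ⊥ := fun h => hf (by simpa [h] using hfP)
  have hV : IsDiscreteValuationRing (Localization.AtPrime P) :=
    IsLocalization.AtPrime.isDiscreteValuationRing_of_dedekind_domain C hP _
  refine ⟨Localization.AtPrime P, inferInstance, inferInstance, hV, inferInstance,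
    IsScalarTower.toAlgHom k C _, ?_, ?_, ?_⟩
  · simpa using hf
  · intro x hx
    simpa using (IsLocalization.AtPrime.to_map_mem_maximal_iff (Localization.AtPrime P) P x).2 hx
  · intro v
    obtain ⟨y, hy⟩ := (IsLocalization.AtPrime.equivQuotMaximalIdeal P
      (Localization.AtPrime P)).surjective (Ideal.Quotient.mk _ v)
    obtain ⟨x, rfl⟩ := Ideal.Quotient.mk_surjective y
    obtain ⟨c, hc⟩ := exists_sub_algebraMap_mem (k := k) P x
    refine ⟨c, ?_⟩
    rw [IsLocalization.AtPrime.equivQuotMaximalIdeal_apply_mk, Ideal.Quotient.eq] at hy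
    have h2 := (IsLocalization.AtPrime.to_map_mem_maximal_iff (Localization.AtPrime P) P _).2 hc
    rw [map_sub, ← IsScalarTower.algebraMap_apply] at h2
    have := sub_mem h2 hy
    convert this using 1
    ring

/-- A possibly singular curve is replaced by its normalization, which is finite over `k[X]` because
the extension of fraction fields is separable; a point over `P` exists by integrality. -/
theorem HasArc.of_finite_polynomial {k : Type*} {B : Type u} [Field k] [CharZero k]
    [IsAlgClosed k] [CommRing B] [IsDomain B] [Algebra k B] [Algebra k[X] B]
    [IsScalarTower k k[X] B] [Module.Finite k[X] B] [FaithfulSMul k[X] B]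
    (P : Ideal B) [P.IsMaximal] {f : B} (hf : f ≠ 0) (hfP : f ∈ P) : HasArc k P f := by
  let L := FractionRing B
  let := FractionRing.liftAlgebra k[X] L
  have : FiniteDimensional (FractionRing k[X]) L := .of_isLocalization k[X] B (nonZeroDivisors k[X])
  let C := integralClosure k[X] L
  have hfinC : Module.Finite k[X] C := IsIntegralClosure.finite k[X] (FractionRing k[X]) L C
  have : Algebra.FiniteType k C := Algebra.FiniteType.trans (S := k[X]) inferInstance inferInstance
  have hint : Algebra.IsIntegral k[X] B := inferInstance
  let ψ : B →ₐ[k[X]] C := IsIntegralClosure.lift k[X] C L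
  have hψL : ∀ b, algebraMap C L (ψ b) = algebraMap B L b := fun b =>
    IsIntegralClosure.algebraMap_lift k[X] C L b
  have hψ : Function.Injective ψ := by
    intro a b hab
    apply IsFractionRing.injective B L
    rw [← hψL, ← hψL, hab]
  let : Algebra B C := ψ.toRingHom.toAlgebra
  have : IsScalarTower k[X] B C := IsScalarTower.of_algebraMap_eq fun x => (ψ.commutes x).symm
  have : Algebra.IsIntegral B C := Algebra.IsIntegral.tower_top k[X]
  obtain ⟨Q, hQ, hQP⟩ := Ideal.exists_ideal_over_maximal_of_isIntegral (S := C) P (by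
    have : RingHom.ker (algebraMap B C) = ⊥ := (RingHom.injective_iff_ker_eq_bot _).1 hψ
    rw [this]; exact bot_le)
  refine HasArc.of_algHom (ψ.restrictScalars k) (P' := Q) ?_ ?_
  · exact hQP.ge
  · refine HasArc.of_isDedekindDomain Q ?_ ?_
    · exact (map_ne_zero_iff ψ hψ).2 hf
    · exact hQP.ge hfP


/-- Reduction to a curve: after Noether normalization take a line in affine space through the image
of `P`, and lift it by going-down to a curve in the variety through `P`. -/
theorem HasArc.of_finiteType {k : Type*} {A : Type u} [Field k] [CharZero k] [IsAlgClosed k]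
    [CommRing A] [IsDomain A] [Algebra k A] [Algebra.FiniteType k A]
    (P : Ideal A) [P.IsMaximal] {f : A} (hf : f ≠ 0) (hfP : f ∈ P) : HasArc k P f := by
  obtain ⟨s, g, hg, hgfin⟩ := exists_finite_inj_algHom_of_fg k A
  let : Algebra (MvPolynomial (Fin s) k) A := g.toRingHom.toAlgebra
  have : Module.Finite (MvPolynomial (Fin s) k) A := hgfin
  have : FaithfulSMul (MvPolynomial (Fin s) k) A := (faithfulSMul_iff_algebraMap_injective (MvPolynomial (Fin s) k) A).2 hg
  choose b hb using fun i => exists_sub_algebraMap_mem (k := k) P (g (MvPolynomial.X i))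
  have hmem : ∀ r, g r ∈ P ↔ MvPolynomial.eval b r = 0 := by
    have h : (Ideal.Quotient.mkₐ k P).comp g =
        (Algebra.ofId k (A ⧸ P)).comp (MvPolynomial.aeval b) := by
      apply MvPolynomial.algHom_ext
      intro i
      have := hb i
      rw [← Ideal.Quotient.eq_zero_iff_mem, map_sub, sub_eq_zero] at this
      simp only [AlgHom.comp_apply, MvPolynomial.aeval_X]
      exact this
    intro r
    rw [← Ideal.Quotient.eq_zero_iff_mem]
    have h2 : Ideal.Quotient.mk P (g r) = algebraMap k (A ⧸ P) (MvPolynomial.eval b r) :=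
      DFunLike.congr_fun h r
    rw [h2, map_eq_zero_iff _ (algebraMap k (A ⧸ P)).injective]
  -- A nonzero multiple of `f` coming from the polynomial ring plays the part of a norm: a line on
  -- which `N` is not identically zero lifts to a curve on which `f` is not.
  obtain ⟨N, hN, hN0⟩ : ∃ N ∈ (Ideal.span {f}).comap (algebraMap (MvPolynomial (Fin s) k) A), N ≠ 0 :=
    Submodule.exists_mem_ne_zero_of_ne_bot
      (Ideal.comap_ne_bot_of_integral_mem hf (Ideal.mem_span_singleton_self f)
        (Algebra.IsIntegral.isIntegral f))
  replace hN : f ∣ g N := Ideal.mem_span_singleton.1 hN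
  obtain ⟨c, hc⟩ : ∃ c : Fin s → k, MvPolynomial.eval c N ≠ 0 := by
    by_contra! h
    exact hN0 (MvPolynomial.funext fun x => by simpa using h x)
  -- Restriction to the line from `b`, the image of `P`, to a point `c` where `N` does not vanish.
  let ψ : MvPolynomial (Fin s) k →ₐ[k] k[X] := MvPolynomial.aeval fun i => C (b i) + X * C (c i - b i)
  have hψb : ∀ r, (ψ r).eval 0 = MvPolynomial.eval b r := by
    intro r
    have : (Polynomial.aeval (0 : k)).comp ψ = MvPolynomial.aeval b := by
      apply MvPolynomial.algHom_ext; intro i; simp [ψ]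
    exact DFunLike.congr_fun this r
  have hψc : ∀ r, (ψ r).eval 1 = MvPolynomial.eval c r := by
    intro r
    have : (Polynomial.aeval (1 : k)).comp ψ = MvPolynomial.aeval c := by
      apply MvPolynomial.algHom_ext; intro i; simp [ψ]
    exact DFunLike.congr_fun this r
  have hbN : MvPolynomial.eval b N = 0 := (hmem N).1 (P.mem_of_dvd hN hfP)
  have hψN : ψ N ≠ 0 := fun h => hc (by rw [← hψc, h, eval_zero])
  obtain ⟨i, hi⟩ : ∃ i, c i - b i ≠ 0 := by
    by_contra! h
    have : c = b := funext fun i => sub_eq_zero.1 (h i)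
    rw [this] at hc
    exact hc hbN
  have hψs : Function.Surjective ψ := by
    rw [← AlgHom.range_eq_top, eq_top_iff, ← Polynomial.adjoin_X, Algebra.adjoin_le_iff]
    rintro _ rfl
    refine ⟨MvPolynomial.C (c i - b i)⁻¹ * (MvPolynomial.X i - MvPolynomial.C (b i)), ?_⟩
    change ψ _ = X
    rw [map_mul, map_sub, MvPolynomial.aeval_X, MvPolynomial.aeval_C, MvPolynomial.aeval_C,
      Polynomial.algebraMap_eq, add_sub_cancel_left, mul_left_comm, ← C_mul, inv_mul_cancel₀ hi,
      C_1, mul_one]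
  let p : Ideal (MvPolynomial (Fin s) k) := RingHom.ker ψ
  have hp : p.IsPrime := RingHom.ker_isPrime ψ
  have hle : p ≤ P.under (MvPolynomial (Fin s) k) := by
    intro r hr
    have h0 : ψ r = 0 := hr
    exact (hmem r).2 (by rw [← hψb, h0, eval_zero])
  -- Going-down, with the polynomial ring as normal base: `A ⧸ Q` is a curve through `P`, finite
  -- over the line.
  obtain ⟨Q, hQP, hQ, hQp⟩ := Ideal.exists_ideal_le_liesOver_of_le P hle
  have hQmem : ∀ r, g r ∈ Q ↔ ψ r = 0 := by
    intro r
    have := hQp.over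
    change r ∈ Q.under (MvPolynomial (Fin s) k) ↔ r ∈ p
    rw [← this]
  let θ : k[X] →ₐ[k] A ⧸ Q :=
    (Ideal.Quotient.liftₐ p ((Ideal.Quotient.mkₐ k Q).comp g) (fun r hr =>
      Ideal.Quotient.eq_zero_iff_mem.2 ((hQmem r).2 hr))).comp
      (Ideal.quotientKerAlgEquivOfSurjective hψs).symm.toAlgHom
  have hθ : ∀ r, θ (ψ r) = Ideal.Quotient.mk Q (g r) := by
    intro r
    have : (Ideal.quotientKerAlgEquivOfSurjective hψs).symm (ψ r) = Ideal.Quotient.mk p r := by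
      rw [AlgEquiv.symm_apply_eq]; rfl
    simp only [θ, AlgHom.comp_apply]
    erw [this]
    rfl
  have hθinj : Function.Injective θ := by
    rw [injective_iff_map_eq_zero]
    intro q hq
    obtain ⟨r, rfl⟩ := hψs q
    rw [hθ, Ideal.Quotient.eq_zero_iff_mem] at hq
    exact (hQmem r).1 hq
  have hθfin : θ.toRingHom.Finite := by
    apply RingHom.Finite.of_comp_finite (f := ψ.toRingHom)
    have : θ.toRingHom.comp ψ.toRingHom = (Ideal.Quotient.mk Q).comp g.toRingHom :=
      RingHom.ext hθ
    rw [this]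
    exact RingHom.Finite.comp (RingHom.Finite.of_surjective _ Ideal.Quotient.mk_surjective) hgfin
  let : Algebra k[X] (A ⧸ Q) := θ.toRingHom.toAlgebra
  have : IsScalarTower k k[X] (A ⧸ Q) :=
    IsScalarTower.of_algebraMap_eq fun x => (θ.commutes x).symm
  have : Module.Finite k[X] (A ⧸ Q) := hθfin
  have : FaithfulSMul k[X] (A ⧸ Q) := (faithfulSMul_iff_algebraMap_injective _ _).2 hθinj
  have : (P.map (Ideal.Quotient.mk Q)).IsMaximal :=
    Ideal.IsMaximal.map_of_surjective_of_ker_le Ideal.Quotient.mk_surjective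
      (by rwa [Ideal.mk_ker])
  refine HasArc.of_algHom (Ideal.Quotient.mkₐ k Q) (P' := P.map (Ideal.Quotient.mk Q))
    Ideal.le_comap_map ?_
  refine HasArc.of_finite_polynomial _ ?_ (Ideal.mem_map_of_mem _ hfP)
  intro h
  have hfQ : f ∈ Q := Ideal.Quotient.eq_zero_iff_mem.1 h
  exact hψN ((hQmem N).1 (Q.mem_of_dvd hN hfQ))

/-! ### Orders of vanishing along a formal curve -/

section DVR

variable {k V : Type*} [Field k] [CommRing V] [IsDomain V] [Algebra k V]

/-- Truncated power series expansion in the uniformizer: it allows differentiation along the curve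
without completing `V`. -/
theorem exists_aeval_approx [IsDiscreteValuationRing V] {π : V} (hπ : Irreducible π)
    (hres : ∀ v : V, ∃ c : k, v - algebraMap k V c ∈ IsLocalRing.maximalIdeal V) (n : ℕ) (v : V) :
    ∃ p : k[X], π ^ n ∣ v - aeval π p := by
  induction n generalizing v with
  | zero => exact ⟨0, by simp⟩
  | succ n ih =>
    obtain ⟨c, hc⟩ := hres v
    rw [hπ.maximalIdeal_eq, Ideal.mem_span_singleton] at hc
    obtain ⟨w, hw⟩ := hc
    obtain ⟨p, z, hz⟩ := ih w
    refine ⟨C c + X * p, z, ?_⟩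
    simp only [map_add, map_mul, aeval_C, aeval_X]
    rw [← sub_sub, hw, ← mul_sub, hz, pow_succ]
    ring

theorem X_pow_dvd_of_pow_dvd_aeval {π : V} (hπ : Irreducible π) {n : ℕ} {p : k[X]}
    (h : π ^ n ∣ aeval π p) : X ^ n ∣ p := by
  induction n generalizing p with
  | zero => simp
  | succ n ih =>
    have hX : X ∣ p := by
      rw [X_dvd_iff]
      by_contra h0
      have h1 : π ∣ aeval π p := (dvd_pow_self π n.succ_ne_zero).trans h
      rw [← divX_mul_X_add p] at h1
      simp only [map_add, map_mul, aeval_X, aeval_C] at h1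
      have h2 : π ∣ algebraMap k V (p.coeff 0) := (dvd_add_right (dvd_mul_left _ _)).1 h1
      exact hπ.not_isUnit (isUnit_of_dvd_unit h2 ((IsUnit.mk0 _ h0).map (algebraMap k V)))
    obtain ⟨q, rfl⟩ := hX
    rw [pow_succ'] at h ⊢
    refine mul_dvd_mul_left X (ih ?_)
    rw [map_mul, aeval_X] at h
    exact (mul_dvd_mul_iff_left hπ.ne_zero).1 h

end DVR

theorem derivative_aeval {σ k : Type*} [Fintype σ] [CommRing k] (p : σ → k[X])
    (f : MvPolynomial σ k) :
    derivative (MvPolynomial.aeval p f) =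
      ∑ i, MvPolynomial.aeval p (MvPolynomial.pderiv i f) * derivative (p i) := by
  classical
  induction f using MvPolynomial.induction_on with
  | C a => simp
  | add f g hf hg => simp [hf, hg, add_mul, Finset.sum_add_distrib]
  | mul_X f j hf =>
    have h : ∀ i, MvPolynomial.aeval p (MvPolynomial.pderiv i (f * MvPolynomial.X j)) *
        derivative (p i) = MvPolynomial.aeval p (MvPolynomial.pderiv i f) * derivative (p i) * p j +
        if j = i then MvPolynomial.aeval p f * derivative (p j) else 0 := by
      intro i
      rw [MvPolynomial.pderiv_mul, MvPolynomial.pderiv_X, Pi.single_apply]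
      split_ifs with hij
      · subst hij
        simp only [map_add, map_mul, MvPolynomial.aeval_X, map_one]
        ring
      · simp only [map_add, map_mul, MvPolynomial.aeval_X, map_zero]
        ring
    simp_rw [h]
    rw [Finset.sum_add_distrib, ← Finset.sum_mul, ← hf]
    simp [derivative_mul]

theorem dvd_aeval_sub_aeval {σ k V : Type*} [Field k] [CommRing V] [Algebra k V] {d : V}
    {x y : σ → V} (h : ∀ i, d ∣ x i - y i) (f : MvPolynomial σ k) :
    d ∣ MvPolynomial.aeval x f - MvPolynomial.aeval y f := by
  induction f using MvPolynomial.induction_on with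
  | C a => simp
  | add f g hf hg =>
    convert dvd_add hf hg using 1
    simp only [map_add]; ring
  | mul_X f j hf =>
    convert dvd_add (hf.mul_right (x j)) ((h j).mul_left (MvPolynomial.aeval y f)) using 1
    simp only [map_mul, MvPolynomial.aeval_X]; ring

/-- Along a formal curve, the order of vanishing of the partial derivatives of `f` cannot all reach
that of `f`. -/
theorem exists_not_dvd_aeval_pderiv {σ k V : Type*} [Fintype σ] [Field k] [CharZero k] [CommRing V]
    [IsDomain V] [IsDiscreteValuationRing V] [Algebra k V]
    (hres : ∀ v : V, ∃ c : k, v - algebraMap k V c ∈ IsLocalRing.maximalIdeal V)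
    (f : MvPolynomial σ k) (x : σ → V) (hf0 : MvPolynomial.aeval x f ≠ 0)
    (hfm : MvPolynomial.aeval x f ∈ IsLocalRing.maximalIdeal V) :
    ∃ i, ¬ MvPolynomial.aeval x f ∣ MvPolynomial.aeval x (MvPolynomial.pderiv i f) := by
  by_contra! hdvd
  obtain ⟨π, hπ⟩ := IsDiscreteValuationRing.exists_irreducible V
  obtain ⟨n, hn⟩ := IsDiscreteValuationRing.associated_pow_irreducible hf0 hπ
  rw [hπ.maximalIdeal_eq, Ideal.mem_span_singleton] at hfm
  -- Precision `n + 1` is one more than the order `n` of `f`, so the polynomial curve `p` sees that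
  -- order exactly.
  choose p hp using fun i => exists_aeval_approx hπ hres (n + 1) (x i)
  have hcongr : ∀ g : MvPolynomial σ k, π ^ (n + 1) ∣
      MvPolynomial.aeval x g - aeval π (MvPolynomial.aeval p g) := by
    intro g
    convert dvd_aeval_sub_aeval hp g using 2
    exact DFunLike.congr_fun (MvPolynomial.algHom_ext (f := (aeval π).comp (MvPolynomial.aeval p))
      (g := MvPolynomial.aeval fun i => aeval π (p i)) fun i => by simp) g
  have hlow : ∀ g : MvPolynomial σ k, π ^ n ∣ MvPolynomial.aeval x g →
      X ^ n ∣ MvPolynomial.aeval p g := by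
    intro g hg
    refine X_pow_dvd_of_pow_dvd_aeval hπ ?_
    exact (dvd_sub_right hg).1 ((pow_dvd_pow π n.le_succ).trans (hcongr g))
  obtain ⟨H, hH⟩ := hlow f hn.symm.dvd
  have hH0 : ¬ X ∣ H := by
    rintro ⟨G, rfl⟩
    have h1 : π ^ (n + 1) ∣ aeval π (MvPolynomial.aeval p f) := by
      rw [hH]; exact ⟨aeval π G, by simp [pow_succ, mul_assoc]⟩
    have h2 : π ^ (n + 1) ∣ MvPolynomial.aeval x f := (dvd_sub_left h1).1 (hcongr f)
    have h3 : π ^ (n + 1) ∣ π ^ n := h2.trans hn.dvd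
    exact absurd ((pow_dvd_pow_iff hπ.ne_zero hπ.not_isUnit).1 h3) (by omega)
  have hn0 : n ≠ 0 := by
    rintro rfl
    exact hπ.not_isUnit (isUnit_of_dvd_one (by simpa using hfm.trans hn.dvd))
  have hder : X ^ n ∣ derivative (MvPolynomial.aeval p f) := by
    rw [derivative_aeval]
    exact Finset.dvd_sum fun i _ => (hlow _ (hn.symm.dvd.trans (hdvd i))).mul_right _
  obtain ⟨m, rfl⟩ := Nat.exists_eq_succ_of_ne_zero hn0
  -- The derivative of X^n H is n X^(n-1) H + X^n H'. If X^n divides it, then X divides n H, which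
  -- is false in characteristic 0.
  rw [hH, derivative_mul, derivative_X_pow] at hder
  have h4 := (dvd_add_left (dvd_mul_right (X ^ (m + 1)) (derivative H))).1 hder
  rw [Nat.succ_eq_add_one, Nat.add_sub_cancel, pow_succ, mul_comm (C _), mul_assoc,
    mul_dvd_mul_iff_left (pow_ne_zero _ X_ne_zero)] at h4
  rcases prime_X.dvd_or_dvd h4 with h5 | h5
  · rw [X_dvd_iff] at h5
    simp at h5
    norm_cast at h5
  · exact hH0 h5

end TrajAM

/-! ### Integral dependence of a polynomial on its Jacobian ideal -/

namespace TrajAM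

theorem finiteType_adjoin_range {k R K ι : Type*} [CommRing k] [CommRing R] [CommRing K]
    [Algebra k R] [Algebra R K] [Algebra k K] [IsScalarTower k R K] [Finite ι]
    [Algebra.FiniteType k R] (g : ι → K) :
    Algebra.FiniteType k (Algebra.adjoin R (Set.range g)) := by
  have : Algebra.FiniteType R (Algebra.adjoin R (Set.range g)) :=
    (Subalgebra.fg_iff_finiteType _).1 (Subalgebra.fg_def.2 ⟨_, Set.finite_range g, rfl⟩)
  exact Algebra.FiniteType.trans (S := R) inferInstance inferInstance

/-- Clearing denominators in a polynomial in the `d i / f`; since `f ∈ I`, terms of lower degree can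
be padded with powers of `f`. -/
theorem exists_mem_pow_of_mem_adjoin {R K ι : Type*} [CommRing R] [Field K] [Algebra R K]
    {f : R} (hf : algebraMap R K f ≠ 0) {d : ι → R} {I : Ideal R} (hfI : f ∈ I)
    (hd : ∀ i, d i ∈ I) {y : K}
    (hy : y ∈ Algebra.adjoin R (Set.range fun i => algebraMap R K (d i) / algebraMap R K f)) :
    ∃ N, ∃ h ∈ I ^ N, algebraMap R K f ^ N * y = algebraMap R K h := by
  induction hy using Algebra.adjoin_induction with
  | mem y hy =>
    obtain ⟨i, rfl⟩ := hy
    exact ⟨1, d i, by simpa using hd i, by field_simp⟩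
  | algebraMap r => exact ⟨0, r, by simp, by simp⟩
  | add y z _ _ hy hz =>
    obtain ⟨N, h, hh, e⟩ := hy
    obtain ⟨N', h', hh', e'⟩ := hz
    refine ⟨N + N', f ^ N' * h + f ^ N * h', ?_, ?_⟩
    · refine add_mem ?_ ?_
      · rw [add_comm, pow_add]; exact Ideal.mul_mem_mul (Ideal.pow_mem_pow hfI _) hh
      · rw [pow_add]; exact Ideal.mul_mem_mul (Ideal.pow_mem_pow hfI _) hh'
    · simp only [map_add, map_mul, map_pow, ← e, ← e']; ring
  | mul y z _ _ hy hz =>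
    obtain ⟨N, h, hh, e⟩ := hy
    obtain ⟨N', h', hh', e'⟩ := hz
    refine ⟨N + N', h * h', ?_, ?_⟩
    · rw [pow_add]; exact Ideal.mul_mem_mul hh hh'
    · simp only [map_mul, ← e, ← e']; ring

/-- Clear denominators in an expression of 1 as an element of the extended ideal. -/
theorem exists_pow_mem_of_map_adjoin_eq_top {R K ι : Type*} [CommRing R] [Field K] [Algebra R K]
    [FaithfulSMul R K] {f : R} (hf : f ≠ 0) {d : ι → R} {I m : Ideal R} (hfI : f ∈ I)
    (hd : ∀ i, d i ∈ I)
    (htop : m.map (algebraMap R (Algebra.adjoin R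
      (Set.range fun i => algebraMap R K (d i) / algebraMap R K f))) = ⊤) :
    ∃ N, f ^ N ∈ m * I ^ N := by
  have hinj := FaithfulSMul.algebraMap_injective R K
  have hf' : algebraMap R K f ≠ 0 := (map_ne_zero_iff _ hinj).2 hf
  set A := Algebra.adjoin R (Set.range fun i => algebraMap R K (d i) / algebraMap R K f) with hA
  have key : ∀ y ∈ m.map (algebraMap R A), ∃ N, ∃ h ∈ m * I ^ N,
      algebraMap R K f ^ N * (y : K) = algebraMap R K h := by
    intro y hy
    induction hy using Submodule.span_induction with
    | mem y hy =>
      obtain ⟨r, hr, rfl⟩ := hy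
      exact ⟨0, r, by simpa using hr, by simp⟩
    | zero => exact ⟨0, 0, zero_mem _, by simp⟩
    | add y z _ _ hy hz =>
      obtain ⟨N, h, hh, e⟩ := hy
      obtain ⟨N', h', hh', e'⟩ := hz
      refine ⟨N + N', f ^ N' * h + f ^ N * h', ?_, ?_⟩
      · refine add_mem ?_ ?_
        · rw [pow_add, ← mul_assoc, mul_comm (f ^ N')]
          exact Ideal.mul_mem_mul hh (Ideal.pow_mem_pow hfI _)
        · rw [add_comm, pow_add, ← mul_assoc, mul_comm (f ^ N)]
          exact Ideal.mul_mem_mul hh' (Ideal.pow_mem_pow hfI _)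
      · simp only [map_add, map_mul, map_pow, Subalgebra.coe_add, ← e, ← e']; ring
    | smul a y _ hy =>
      obtain ⟨N, h, hh, e⟩ := hy
      obtain ⟨N', h', hh', e'⟩ := exists_mem_pow_of_mem_adjoin hf' hfI hd a.2
      refine ⟨N + N', h * h', ?_, ?_⟩
      · rw [pow_add, ← mul_assoc]; exact Ideal.mul_mem_mul hh hh'
      · simp only [map_mul, smul_eq_mul, Subalgebra.coe_mul, ← e, ← e']; ring
  obtain ⟨N, h, hh, e⟩ := key 1 (by rw [htop]; trivial)
  refine ⟨N, ?_⟩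
  have : f ^ N = h := hinj (by simpa using e)
  rwa [this]

/-- A polynomial that vanishes at `a` is, near `a`, integral over the product of the maximal ideal
of `a` and its Jacobian ideal. -/
theorem exists_pow_mem_ker_eval_mul_pow {σ k : Type*} [Fintype σ] [Field k] [CharZero k]
    [IsAlgClosed k] (f : MvPolynomial σ k) (a : σ → k) (hfa : MvPolynomial.eval a f = 0) :
    ∃ N, f ^ N ∈ RingHom.ker (MvPolynomial.eval a) *
      Ideal.span (insert f (Set.range fun i => MvPolynomial.pderiv i f)) ^ N := by
  by_cases hf : f = 0
  · exact ⟨1, by simp [hf]⟩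
  set I := Ideal.span (insert f (Set.range fun i => MvPolynomial.pderiv i f)) with hI
  have hfI : f ∈ I := Ideal.subset_span (Set.mem_insert _ _)
  have hdI : ∀ i, MvPolynomial.pderiv i f ∈ I := fun i =>
    Ideal.subset_span (Set.mem_insert_of_mem _ ⟨i, rfl⟩)
  let K := FractionRing (MvPolynomial σ k)
  let g : σ → K := fun i =>
    algebraMap (MvPolynomial σ k) K (MvPolynomial.pderiv i f) / algebraMap (MvPolynomial σ k) K f
  let A := Algebra.adjoin (MvPolynomial σ k) (Set.range g)
  by_cases htop : (RingHom.ker (MvPolynomial.eval a)).map (algebraMap (MvPolynomial σ k) A) = ⊤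
  · exact exists_pow_mem_of_map_adjoin_eq_top (K := K) hf hfI hdI htop
  exfalso
  -- `P` is a point of the blow-up chart over `a`.
  obtain ⟨P, hP, hle⟩ := Ideal.exists_le_maximal _ htop
  have hfin : Algebra.FiniteType k A := finiteType_adjoin_range g
  have hinj : Function.Injective (algebraMap (MvPolynomial σ k) K) := IsFractionRing.injective _ _
  have hfK : algebraMap (MvPolynomial σ k) K f ≠ 0 := (map_ne_zero_iff _ hinj).2 hf
  have hfA : algebraMap (MvPolynomial σ k) A f ≠ 0 := fun h => hfK (congrArg Subtype.val h)
  have hfP : algebraMap (MvPolynomial σ k) A f ∈ P := hle (Ideal.mem_map_of_mem _ hfa)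
  obtain ⟨V, i1, i2, i3, i4, φ, h1, h2, h3⟩ := HasArc.of_finiteType (k := k) P hfA hfP
  let χ : MvPolynomial σ k →ₐ[k] V := φ.comp (IsScalarTower.toAlgHom k (MvPolynomial σ k) A)
  have hχ : ∀ r, MvPolynomial.aeval (fun i => χ (MvPolynomial.X i)) r =
      φ (algebraMap (MvPolynomial σ k) A r) := by
    intro r
    exact (DFunLike.congr_fun (MvPolynomial.aeval_unique χ) r).symm
  obtain ⟨i, hi⟩ := exists_not_dvd_aeval_pderiv h3 f (fun i => χ (MvPolynomial.X i))
    (by rw [hχ]; exact h1) (by rw [hχ]; exact h2 _ hfP)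
  rw [hχ, hχ] at hi
  -- In the chart, ∂_i f is f times the generator `g i`, and `φ` preserves this divisibility.
  refine hi (map_dvd φ ⟨⟨g i, Algebra.subset_adjoin ⟨i, rfl⟩⟩, Subtype.ext ?_⟩)
  change algebraMap (MvPolynomial σ k) K (MvPolynomial.pderiv i f) =
    algebraMap (MvPolynomial σ k) K f * g i
  exact (mul_div_cancel₀ _ hfK).symm

end TrajAM

/-! ### From ideal membership to the gradient inequality for real polynomials -/

namespace TrajAM

open Asymptotics

section IdealBounds

variable {R α : Type*} [CommRing R] {l : Filter α} (ev : α → R →+* ℂ)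

theorem isBigO_of_mem_span (hbd : ∀ r, (fun x => ev x r) =O[l] fun _ => (1 : ℝ)) {s : Set R}
    {φ : α → ℝ} (hs : ∀ h ∈ s, (fun x => ev x h) =O[l] φ) {h : R} (hh : h ∈ Ideal.span s) :
    (fun x => ev x h) =O[l] φ := by
  induction hh using Submodule.span_induction with
  | mem h hh => exact hs h hh
  | zero => simpa using isBigO_zero φ l
  | add y z _ _ hy hz => simpa using hy.add hz
  | smul a y _ hy => simpa using (hbd a).mul hy

theorem isBigO_pow_of_mem_pow (hbd : ∀ r, (fun x => ev x r) =O[l] fun _ => (1 : ℝ)) {I : Ideal R}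
    {φ : α → ℝ} (hI : ∀ h ∈ I, (fun x => ev x h) =O[l] φ) (N : ℕ) {h : R} (hh : h ∈ I ^ N) :
    (fun x => ev x h) =O[l] fun x => φ x ^ N := by
  induction N generalizing h with
  | zero => simpa using hbd h
  | succ N ih =>
    rw [pow_succ] at hh
    induction hh using Submodule.mul_induction_on' with
    | mem_mul_mem a ha b hb => simpa [pow_succ] using (ih ha).mul (hI b hb)
    | add a _ b _ ha hb => simpa using ha.add hb

theorem isLittleO_of_mem_mul {m I : Ideal R} {φ : α → ℝ}
    (hm : ∀ h ∈ m, (fun x => ev x h) =o[l] fun _ => (1 : ℝ))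
    (hI : ∀ h ∈ I, (fun x => ev x h) =O[l] φ) {h : R} (hh : h ∈ m * I) :
    (fun x => ev x h) =o[l] φ := by
  induction hh using Submodule.mul_induction_on' with
  | mem_mul_mem a ha b hb => simpa using (hm a ha).mul_isBigO (hI b hb)
  | add a _ b _ ha hb => simpa using ha.add hb

end IdealBounds

theorem eval_map_ofReal {σ : Type*} (f : MvPolynomial σ ℝ) (x : σ → ℝ) :
    MvPolynomial.eval (fun i => (x i : ℂ)) (MvPolynomial.map Complex.ofRealHom f) =
      (MvPolynomial.eval x f : ℂ) := by
  rw [MvPolynomial.eval_map]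
  exact (MvPolynomial.eval₂_comp Complex.ofRealHom x f).symm

/-- Gradient inequality of Łojasiewicz and Bochnak type for polynomials. -/
theorem eventually_abs_eval_le_sum_pderiv {σ : Type*} [Fintype σ] (f : MvPolynomial σ ℝ)
    (a : σ → ℝ) (hfa : MvPolynomial.eval a f = 0) {ε : ℝ} (hε : 0 < ε) :
    ∀ᶠ x in 𝓝 a, |MvPolynomial.eval x f| ≤
      ε * ∑ i, |MvPolynomial.eval x (MvPolynomial.pderiv i f)| := by
  -- The algebra needs an algebraically closed field, so `f` is complexified, but it is evaluated at
  -- real points only.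
  let F : MvPolynomial σ ℂ := MvPolynomial.map Complex.ofRealHom f
  let ev : (σ → ℝ) → MvPolynomial σ ℂ →+* ℂ := fun x => MvPolynomial.eval fun i => (x i : ℂ)
  let φ : (σ → ℝ) → ℝ := fun x =>
    |MvPolynomial.eval x f| + ∑ i, |MvPolynomial.eval x (MvPolynomial.pderiv i f)|
  have hφ0 : ∀ x, 0 ≤ ∑ i, |MvPolynomial.eval x (MvPolynomial.pderiv i f)| := fun x =>
    Finset.sum_nonneg fun i _ => abs_nonneg _
  have hcont : ∀ r, Continuous fun x => ev x r := fun r =>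
    (MvPolynomial.continuous_eval r).comp (by fun_prop)
  have hbd : ∀ r, (fun x => ev x r) =O[𝓝 a] fun _ => (1 : ℝ) := fun r =>
    (hcont r).continuousAt.isBigO_one ℝ
  have hF : ∀ x, ev x F = (MvPolynomial.eval x f : ℂ) := eval_map_ofReal f
  have hdF : ∀ x i, ev x (MvPolynomial.pderiv i F) =
      (MvPolynomial.eval x (MvPolynomial.pderiv i f) : ℂ) := fun x i => by
    rw [MvPolynomial.pderiv_map]; exact eval_map_ofReal _ x
  obtain ⟨N, hN⟩ := exists_pow_mem_ker_eval_mul_pow F (fun i => (a i : ℂ))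
    (by change ev a F = 0; rw [hF, hfa]; simp)
  set I := Ideal.span (insert F (Set.range fun i => MvPolynomial.pderiv i F)) with hI
  have hIbd : ∀ h ∈ I, (fun x => ev x h) =O[𝓝 a] φ := by
    intro h hh
    refine isBigO_of_mem_span ev hbd ?_ hh
    rintro h (rfl | ⟨i, rfl⟩)
    · refine IsBigO.of_bound 1 (Eventually.of_forall fun x => ?_)
      rw [hF, Complex.norm_real, one_mul, Real.norm_eq_abs]
      exact (le_add_of_nonneg_right (hφ0 x)).trans (le_abs_self _)
    · refine IsBigO.of_bound 1 (Eventually.of_forall fun x => ?_)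
      rw [hdF, Complex.norm_real, one_mul, Real.norm_eq_abs]
      exact ((Finset.single_le_sum (f := fun j =>
        |MvPolynomial.eval x (MvPolynomial.pderiv j f)|) (fun j _ => abs_nonneg _)
        (Finset.mem_univ i)).trans (le_add_of_nonneg_left (abs_nonneg _))).trans (le_abs_self _)
  have hm : ∀ h ∈ RingHom.ker (MvPolynomial.eval fun i => (a i : ℂ)),
      (fun x => ev x h) =o[𝓝 a] fun _ => (1 : ℝ) := by
    intro h hh
    rw [isLittleO_one_iff]
    have := (hcont h).tendsto a
    rwa [show ev a h = 0 from hh] at this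
  have ho : (fun x => ev x (F ^ N)) =o[𝓝 a] fun x => φ x ^ N :=
    isLittleO_of_mem_mul ev hm (fun h hh => isBigO_pow_of_mem_pow ev hbd hIbd N hh) hN
  have hN0 : N ≠ 0 := by
    rintro rfl
    simp at hN
  -- Chosen so that |f| ≤ c (|f| + ∑ |∂_i f|) rearranges to |f| ≤ ε ∑ |∂_i f|.
  set c := ε / (1 + ε) with hc
  have hc0 : 0 < c := by positivity
  filter_upwards [ho.def (pow_pos hc0 N)] with x hx
  rw [map_pow, norm_pow, hF, Complex.norm_real, Real.norm_eq_abs, norm_pow, ← mul_pow] at hx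
  have hφx : ‖φ x‖ = φ x := Real.norm_of_nonneg (add_nonneg (abs_nonneg _) (hφ0 x))
  rw [hφx] at hx
  have h2 := (pow_le_pow_iff_left₀ (abs_nonneg _)
    (mul_nonneg hc0.le (add_nonneg (abs_nonneg _) (hφ0 x))) hN0).1 hx
  simp only [hc] at h2
  rw [div_mul_eq_mul_div, le_div_iff₀ (by positivity)] at h2
  linarith

end TrajAM

/-! ### Rational functions: gradient inequality and gain of a coordinate move -/

namespace TrajAM

section Quotient

variable {σ : Type*}

/-- Taylor expansion along one coordinate; joint continuity of the remainder makes the later bounds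
uniform near a point. -/
theorem exists_eval_add_single [DecidableEq σ] (p : MvPolynomial σ ℝ) (i : σ) :
    ∃ R : (σ → ℝ) × ℝ → ℝ, Continuous R ∧ ∀ x s,
      MvPolynomial.eval (x + Pi.single i s) p = MvPolynomial.eval x p +
        s * MvPolynomial.eval x (MvPolynomial.pderiv i p) + s ^ 2 * R (x, s) := by
  induction p using MvPolynomial.induction_on with
  | C c => exact ⟨fun _ => 0, continuous_const, by simp⟩
  | add p q hp hq =>
    obtain ⟨R, hR, h⟩ := hp
    obtain ⟨R', hR', h'⟩ := hq
    exact ⟨fun z => R z + R' z, hR.add hR', fun x s => by simp only [map_add, h, h']; ring⟩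
  | mul_X p j hp =>
    obtain ⟨R, hR, h⟩ := hp
    have hcont : Continuous fun x => MvPolynomial.eval x (MvPolynomial.pderiv i p) :=
      MvPolynomial.continuous_eval _
    by_cases hij : j = i
    · subst hij
      refine ⟨fun z => R z * (z.1 j + z.2) + MvPolynomial.eval z.1 (MvPolynomial.pderiv j p),
        by fun_prop, fun x s => ?_⟩
      simp only [MvPolynomial.pderiv_mul, MvPolynomial.pderiv_X_self, map_add, map_mul,
        MvPolynomial.eval_X, h, Pi.add_apply, Pi.single_eq_same, mul_one]
      ring
    · refine ⟨fun z => R z * z.1 j, by fun_prop, fun x s => ?_⟩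
      simp only [MvPolynomial.pderiv_mul, MvPolynomial.pderiv_X_of_ne hij,
        map_mul, MvPolynomial.eval_X, h, Pi.add_apply, Pi.single_eq_of_ne hij, mul_zero, add_zero]
      ring

/-- The rational function `p / q`. -/
noncomputable def quot (p q : MvPolynomial σ ℝ) (x : σ → ℝ) : ℝ :=
  MvPolynomial.eval x p / MvPolynomial.eval x q

/-- The partial derivative of the rational function `p / q`. -/
noncomputable def quotDeriv (p q : MvPolynomial σ ℝ) (i : σ) (x : σ → ℝ) : ℝ :=
  (MvPolynomial.eval x (MvPolynomial.pderiv i p) -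
    quot p q x * MvPolynomial.eval x (MvPolynomial.pderiv i q)) / MvPolynomial.eval x q

variable {p q : MvPolynomial σ ℝ} {a : σ → ℝ}

theorem continuousAt_quot (ha : MvPolynomial.eval a q ≠ 0) : ContinuousAt (quot p q) a :=
  (MvPolynomial.continuous_eval p).continuousAt.div
    (MvPolynomial.continuous_eval q).continuousAt ha

theorem continuousAt_quotDeriv (ha : MvPolynomial.eval a q ≠ 0) (i : σ) :
    ContinuousAt (quotDeriv p q i) a :=
  ((MvPolynomial.continuous_eval _).continuousAt.sub ((continuousAt_quot ha).mul
    (MvPolynomial.continuous_eval _).continuousAt)).div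
    (MvPolynomial.continuous_eval q).continuousAt ha

theorem exists_quot_add_single_le [DecidableEq σ] (ha : MvPolynomial.eval a q ≠ 0) (i : σ) :
    ∃ L > 0, ∀ᶠ z : (σ → ℝ) × ℝ in 𝓝 (a, 0),
    quot p q (z.1 + Pi.single i z.2) ≤
      quot p q z.1 + z.2 * quotDeriv p q i z.1 + L * z.2 ^ 2 := by
  obtain ⟨R, hR, hp⟩ := exists_eval_add_single p i
  obtain ⟨R', hR', hq⟩ := exists_eval_add_single q i
  have hfst : ContinuousAt (Prod.fst : (σ → ℝ) × ℝ → σ → ℝ) (a, 0) := continuousAt_fst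
  have hqc : Continuous fun z : (σ → ℝ) × ℝ => MvPolynomial.eval (z.1 + Pi.single i z.2) q := by
    have : Continuous fun z : (σ → ℝ) × ℝ => z.1 + Pi.single i z.2 :=
      continuous_fst.add ((continuous_single i).comp continuous_snd)
    exact (MvPolynomial.continuous_eval q).comp this
  -- Second-order remainder of the quotient, found by solving the expansions of `p` and `q` for it.
  let E : (σ → ℝ) × ℝ → ℝ := fun z =>
    (R z - MvPolynomial.eval z.1 (MvPolynomial.pderiv i q) * quotDeriv p q i z.1 -
      R' z * (quot p q z.1 + z.2 * quotDeriv p q i z.1)) /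
        MvPolynomial.eval (z.1 + Pi.single i z.2) q
  have hE : ContinuousAt E (a, 0) := by
    have h1 : ContinuousAt (fun z : (σ → ℝ) × ℝ => quotDeriv p q i z.1) (a, 0) :=
      ContinuousAt.comp (f := Prod.fst) (x := (a, (0 : ℝ))) (continuousAt_quotDeriv ha i) hfst
    have h2 : ContinuousAt (fun z : (σ → ℝ) × ℝ => quot p q z.1) (a, 0) :=
      ContinuousAt.comp (f := Prod.fst) (x := (a, (0 : ℝ))) (continuousAt_quot ha) hfst
    have h3 : ContinuousAt (fun z : (σ → ℝ) × ℝ =>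
        MvPolynomial.eval z.1 (MvPolynomial.pderiv i q)) (a, 0) :=
      ((MvPolynomial.continuous_eval _).comp continuous_fst).continuousAt
    refine ContinuousAt.div ?_ hqc.continuousAt (by simpa using ha)
    exact (hR.continuousAt.sub (h3.mul h1)).sub
      (hR'.continuousAt.mul (h2.add (continuousAt_snd.mul h1)))
  refine ⟨|E (a, 0)| + 1, by positivity, ?_⟩
  have hq0 : ∀ᶠ z : (σ → ℝ) × ℝ in 𝓝 (a, 0), MvPolynomial.eval z.1 q ≠ 0 :=
    ((MvPolynomial.continuous_eval q).comp continuous_fst).continuousAt.eventually_ne ha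
  have hq1 : ∀ᶠ z : (σ → ℝ) × ℝ in 𝓝 (a, 0),
      MvPolynomial.eval (z.1 + Pi.single i z.2) q ≠ 0 :=
    hqc.continuousAt.eventually_ne (by simpa using ha)
  have hE1 : ∀ᶠ z in 𝓝 (a, (0 : ℝ)), E z < |E (a, 0)| + 1 :=
    hE.eventually_lt_const ((le_abs_self _).trans_lt (lt_add_one _))
  filter_upwards [hq0, hq1, hE1] with z h0 h1 h2
  have key : quot p q (z.1 + Pi.single i z.2) =
      quot p q z.1 + z.2 * quotDeriv p q i z.1 + E z * z.2 ^ 2 := by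
    have hpz := hp z.1 z.2
    have hqz := hq z.1 z.2
    simp only [E, quotDeriv, quot]
    field_simp
    rw [hpz, hqz]
    ring
  rw [key]
  gcongr

/-- Apply the polynomial inequality to f = p - (p/q)(a) q. Its gradient is q ∇(p/q) plus an error
(p/q - (p/q)(a)) ∇q, absorbed on the left because ε may be taken small. -/
theorem eventually_abs_quot_sub_le [Fintype σ] (ha : MvPolynomial.eval a q ≠ 0) :
    ∃ C > 0, ∀ᶠ x in 𝓝 a, |quot p q x - quot p q a| ≤ C * ∑ i, |quotDeriv p q i x| := by
  let f : MvPolynomial σ ℝ := p - MvPolynomial.C (quot p q a) * q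
  have hfa : MvPolynomial.eval a f = 0 := by
    simp only [f, quot, map_sub, map_mul, MvPolynomial.eval_C]
    field_simp
    ring
  set q0 := |MvPolynomial.eval a q| with hq0
  have hq0pos : 0 < q0 := abs_pos.2 ha
  have hqc : ContinuousAt (fun x => |MvPolynomial.eval x q|) a :=
    (MvPolynomial.continuous_eval q).abs.continuousAt
  have hBc : ContinuousAt (fun x => ∑ i, |MvPolynomial.eval x (MvPolynomial.pderiv i q)|) a :=
    (continuous_finsetSum _ fun i _ => (MvPolynomial.continuous_eval _).abs).continuousAt
  obtain ⟨B, hB, hBpos⟩ : ∃ B, ∑ i, |MvPolynomial.eval a (MvPolynomial.pderiv i q)| < B ∧ 0 < B :=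
    ⟨_, lt_add_one _, add_pos_of_nonneg_of_pos (Finset.sum_nonneg fun i _ => abs_nonneg _) one_pos⟩
  -- With |q| > q0/2 near `a`, this ε lets the error use up half of the left side (q0/2) δ.
  obtain ⟨ε, hεpos, h7⟩ : ∃ ε > 0, ε * B = q0 / 4 :=
    ⟨q0 / 4 / B, div_pos (by linarith) hBpos, div_mul_cancel₀ _ hBpos.ne'⟩
  refine ⟨8 * ε, by positivity, ?_⟩
  filter_upwards [hqc.eventually_const_lt (half_lt_self hq0pos),
    hqc.eventually_lt_const (show |MvPolynomial.eval a q| < 2 * q0 by linarith),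
    hBc.eventually_lt_const hB,
    eventually_abs_eval_le_sum_pderiv f a hfa hεpos] with x h1 h2 h3 h4
  have hqx : MvPolynomial.eval x q ≠ 0 := abs_pos.1 ((half_pos hq0pos).trans h1)
  have hfx : MvPolynomial.eval x f =
      MvPolynomial.eval x q * (quot p q x - quot p q a) := by
    have : MvPolynomial.eval x q * quot p q x = MvPolynomial.eval x p := by
      simp only [quot]; field_simp
    simp only [f, map_sub, map_mul, MvPolynomial.eval_C]
    linear_combination -this
  have hdf : ∀ i, MvPolynomial.eval x (MvPolynomial.pderiv i f) =
      MvPolynomial.eval x q * quotDeriv p q i x +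
        (quot p q x - quot p q a) * MvPolynomial.eval x (MvPolynomial.pderiv i q) := by
    intro i
    have : MvPolynomial.eval x q * quotDeriv p q i x =
        MvPolynomial.eval x (MvPolynomial.pderiv i p) -
          quot p q x * MvPolynomial.eval x (MvPolynomial.pderiv i q) := by
      simp only [quotDeriv]; field_simp
    rw [this]
    simp only [f, map_sub, MvPolynomial.pderiv_C_mul, map_mul, MvPolynomial.eval_C]
    ring
  set δ := |quot p q x - quot p q a| with hδ
  have hδ0 : 0 ≤ δ := abs_nonneg _
  have h5 : ∑ i, |MvPolynomial.eval x (MvPolynomial.pderiv i f)| ≤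
      2 * q0 * ∑ i, |quotDeriv p q i x| + δ * B := by
    calc ∑ i, |MvPolynomial.eval x (MvPolynomial.pderiv i f)|
        ≤ ∑ i, (2 * q0 * |quotDeriv p q i x| +
          δ * |MvPolynomial.eval x (MvPolynomial.pderiv i q)|) := by
          refine Finset.sum_le_sum fun i _ => ?_
          rw [hdf]
          refine (abs_add_le _ _).trans ?_
          rw [abs_mul, abs_mul]
          gcongr
      _ = 2 * q0 * ∑ i, |quotDeriv p q i x| +
          δ * ∑ i, |MvPolynomial.eval x (MvPolynomial.pderiv i q)| := by
          rw [Finset.sum_add_distrib, Finset.mul_sum, Finset.mul_sum]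
      _ ≤ _ := by gcongr
  rw [hfx, abs_mul] at h4
  have h6 : q0 / 2 * δ ≤ ε * (2 * q0 * ∑ i, |quotDeriv p q i x| + δ * B) :=
    (mul_le_mul_of_nonneg_right h1.le hδ0).trans
      (h4.trans (mul_le_mul_of_nonneg_left h5 hεpos.le))
  have h8 : q0 * δ ≤ q0 * (8 * ε * ∑ i, |quotDeriv p q i x|) := by
    linear_combination 4 * h6 + 4 * δ * h7
  exact le_of_mul_le_mul_left h8 hq0pos

/-- A gradient step s = -α g along the coordinate lowers the function by at least α g² / 2, and η
bounds that gain. -/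
theorem exists_sq_quotDeriv_le [DecidableEq σ] (ha : MvPolynomial.eval a q ≠ 0) (i : σ) {r : ℝ}
    (hr : 0 < r) : ∃ C > 0, ∀ᶠ x in 𝓝 a, ∀ η,
    (∀ s, |s| ≤ r → quot p q x - η ≤ quot p q (x + Pi.single i s)) →
      quotDeriv p q i x ^ 2 ≤ C * η := by
  obtain ⟨L, hL, hexp⟩ := exists_quot_add_single_le (p := p) ha i
  rw [nhds_prod_eq, eventually_prod_iff] at hexp
  obtain ⟨pa, hpa, pb, hpb, hexp⟩ := hexp
  obtain ⟨r', hr', hpb⟩ := Metric.eventually_nhds_iff.1 hpb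
  set B := |quotDeriv p q i a| + 1 with hB
  have hBpos : 0 < B := by positivity
  -- The first bound makes the quadratic error at most half of the linear gain; the second keeps the
  -- step within `r` and within the range of the expansion.
  set α := min (1 / (2 * L)) (min r (r' / 2) / B) with hα
  have hαpos : 0 < α := by positivity
  have hαL : α * L ≤ 1 / 2 := by
    have : α ≤ 1 / (2 * L) := min_le_left _ _
    calc α * L ≤ 1 / (2 * L) * L := by gcongr
      _ = 1 / 2 := by field_simp
  have hαB : α * B ≤ min r (r' / 2) := (le_div_iff₀ hBpos).1 (min_le_right _ _)
  refine ⟨2 / α, by positivity, ?_⟩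
  filter_upwards [hpa, (continuousAt_quotDeriv (p := p) ha i).abs.eventually_lt_const
    (lt_add_one _)] with x hx hxB η hη
  set g := quotDeriv p q i x with hg
  have hs : |-(α * g)| ≤ min r (r' / 2) := by
    rw [abs_neg, abs_mul, abs_of_pos hαpos]
    exact (mul_le_mul_of_nonneg_left hxB.le hαpos.le).trans hαB
  have h1 := hη _ (hs.trans (min_le_left _ _))
  have h2 := hexp hx (hpb (y := -(α * g)) (by
    rw [Real.dist_eq, sub_zero]
    exact (hs.trans (min_le_right _ _)).trans_lt (by linarith)))
  simp only at h2
  have h3 : α * g ^ 2 * (1 - α * L) ≤ η := by linear_combination h1 + h2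
  have h4 : α * g ^ 2 * (1 / 2) ≤ α * g ^ 2 * (1 - α * L) := by
    gcongr; linarith
  rw [div_mul_eq_mul_div, le_div_iff₀ hαpos]
  linarith

/-- Near `a`, if no coordinate move of length at most `r` lowers `p / q` by more than `η`, then the
value of `p / q` is within `O(√η)` of its value at `a`. -/
theorem exists_sq_quot_sub_le [Fintype σ] [DecidableEq σ] (ha : MvPolynomial.eval a q ≠ 0) {r : ℝ}
    (hr : 0 < r) : ∃ C > 0, ∀ᶠ x in 𝓝 a, ∀ η, 0 ≤ η →
    (∀ i s, |s| ≤ r → quot p q x - η ≤ quot p q (x + Pi.single i s)) →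
      (quot p q x - quot p q a) ^ 2 ≤ C * η := by
  obtain ⟨C, hC, hgrad⟩ := eventually_abs_quot_sub_le (p := p) ha
  choose c hc hstep using fun i => exists_sq_quotDeriv_le (p := p) ha i hr
  -- The summand 1 keeps the constant positive when there are no coordinates.
  refine ⟨C ^ 2 * (Fintype.card σ * ∑ i, c i) + 1, ?_, ?_⟩
  · have : 0 ≤ ∑ i, c i := Finset.sum_nonneg fun i _ => (hc i).le
    positivity
  filter_upwards [hgrad, eventually_all.2 hstep] with x h1 h2 η h0 hη
  have h3 : ∀ i, quotDeriv p q i x ^ 2 ≤ c i * η := fun i => h2 i η (hη i)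
  have hcs : (∑ i, |quotDeriv p q i x|) ^ 2 ≤ Fintype.card σ * ∑ i, c i * η := by
    refine (sq_sum_le_card_mul_sum_sq (s := Finset.univ)).trans ?_
    rw [Finset.card_univ]
    gcongr with i
    rw [sq_abs]
    exact h3 i
  have hη0 : (quot p q x - quot p q a) ^ 2 ≤ C ^ 2 * (Fintype.card σ * ∑ i, c i * η) := by
    rw [← sq_abs]
    calc |quot p q x - quot p q a| ^ 2 ≤ (C * ∑ i, |quotDeriv p q i x|) ^ 2 := by gcongr
      _ = C ^ 2 * (∑ i, |quotDeriv p q i x|) ^ 2 := by ring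
      _ ≤ _ := by gcongr
  rw [← Finset.sum_mul] at hη0
  linarith

end Quotient

end TrajAM

/-! ### The objective is a rational function -/

namespace TrajAM

open Polynomial

theorem expo_injective {S : ℕ} : Function.Injective (expo : Idx S → ℕ) := by
  rintro (i | i) (j | j) h <;> simp only [expo] at h
  · exact congrArg _ (Fin.ext h)
  · have := i.2; omega
  · have := j.2; omega
  · exact congrArg _ (Fin.ext (by omega))

theorem expo_lt {S : ℕ} (c : Idx S) : expo c < 2 * S := by
  rcases c with i | i <;> simp only [expo] <;> omega

theorem iterate_derivative_sum_eval {S : ℕ} (v : Idx S → ℝ) (i : ℕ) (t : ℝ) :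
    (derivative^[i] (∑ c, C (v c) * X ^ expo c)).eval t =
      ∑ c, v c * (derivative^[i] (X ^ expo c : ℝ[X])).eval t := by
  rw [iterate_derivative_sum, eval_finsetSum]
  simp [iterate_derivative_C_mul]

theorem X_sub_C_pow_dvd_of_iterate_derivative_eval_eq_zero {p : ℝ[X]} {t : ℝ} {n : ℕ}
    (h : ∀ i < n, (derivative^[i] p).eval t = 0) : (X - C t) ^ n ∣ p := by
  by_cases hp : p = 0
  · simp [hp]
  rw [← le_rootMultiplicity_iff hp]
  rcases n with _ | n
  · exact Nat.zero_le _
  · exact lt_rootMultiplicity_of_isRoot_iterate_derivative hp fun m hm => h m (by omega)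

/-- Uniqueness of Hermite interpolation: a kernel vector gives a polynomial of degree below 2S
divisible by X^S (X - T)^S. -/
theorem det_mapMat_ne_zero (S : ℕ) {T : ℝ} (hT : T ≠ 0) : (mapMat S T).det ≠ 0 := by
  intro hdet
  obtain ⟨v, hv, hMv⟩ := Matrix.exists_mulVec_eq_zero_iff.2 hdet
  let p : ℝ[X] := ∑ c, C (v c) * X ^ expo c
  have hrow : ∀ r, ∑ c, mapMat S T r c * v c = 0 := fun r => congrFun hMv r
  have h0 : (X - C 0) ^ S ∣ p := X_sub_C_pow_dvd_of_iterate_derivative_eval_eq_zero fun i hi => by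
    rw [iterate_derivative_sum_eval]
    refine Eq.trans (Finset.sum_congr rfl fun c _ => mul_comm _ _) (hrow (Sum.inl ⟨i, hi⟩))
  have hT' : (X - C T) ^ S ∣ p := X_sub_C_pow_dvd_of_iterate_derivative_eval_eq_zero fun i hi => by
    rw [iterate_derivative_sum_eval]
    refine Eq.trans (Finset.sum_congr rfl fun c _ => mul_comm _ _) (hrow (Sum.inr ⟨i, hi⟩))
  have hcop : IsCoprime ((X - C 0 : ℝ[X]) ^ S) ((X - C T) ^ S) :=
    (isCoprime_X_sub_C_of_isUnit_sub (by simpa using hT)).pow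
  have hdvd := hcop.mul_dvd h0 hT'
  have hdeg : p.degree < ((X - C 0 : ℝ[X]) ^ S * (X - C T) ^ S).degree := by
    have h1 : ((X - C 0 : ℝ[X]) ^ S * (X - C T) ^ S).degree = ((2 * S : ℕ) : WithBot ℕ) := by
      rw [degree_mul, degree_pow, degree_pow, degree_X_sub_C, degree_X_sub_C]
      push_cast
      simp [two_mul]
    rw [h1]
    refine (degree_sum_le _ _).trans_lt ((Finset.sup_lt_iff (WithBot.bot_lt_coe _)).2 fun c _ => ?_)
    exact (degree_C_mul_X_pow_le _ _).trans_lt (by exact_mod_cast expo_lt c)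
  have hp0 : p = 0 := eq_zero_of_dvd_of_degree_lt hdvd hdeg
  refine hv (funext fun c => ?_)
  have hc : p.coeff (expo c) = v c := by
    simp only [p, finsetSum_coeff, coeff_C_mul, coeff_X_pow, expo_injective.eq_iff, mul_ite,
      mul_one, mul_zero, Finset.sum_ite_eq, Finset.mem_univ, if_true]
  rw [← hc, hp0]; simp

theorem exists_integral_eval (Q : ℝ[X]) : ∃ R : ℝ[X], ∀ T : ℝ,
    ∫ t in (0 : ℝ)..T, Q.eval t = R.eval T := by
  induction Q using Polynomial.induction_on' with
  | add p q hp hq =>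
    obtain ⟨R, hR⟩ := hp
    obtain ⟨R', hR'⟩ := hq
    refine ⟨R + R', fun T => ?_⟩
    simp only [eval_add]
    rw [intervalIntegral.integral_add (p.continuous.intervalIntegrable _ _)
      (q.continuous.intervalIntegrable _ _), hR, hR']
  | monomial n a =>
    refine ⟨C (a / (n + 1)) * X ^ (n + 1), fun T => ?_⟩
    simp only [eval_monomial, intervalIntegral.integral_const_mul, integral_pow, eval_mul, eval_C,
      eval_pow, eval_X]
    simp
    ring

/-- The cost of a piece is a quadratic form in the coefficients of the piece, with entries that are
polynomials in the duration. -/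
theorem exists_pieceCost_eq {S : ℕ} (W : Weights) : ∃ R : ℕ → Idx S → Idx S → ℝ[X],
    ∀ (d : Matrix (Idx S) (Fin 3) ℝ) (T : ℝ), pieceCost W d T = W.rho * T +
      ∑ i ∈ Finset.Icc W.Dmin W.Dmax, W.w i * ∑ a : Fin 3, ∑ c, ∑ c',
        ((mapMat S T)⁻¹ * d) c a * ((mapMat S T)⁻¹ * d) c' a * (R i c c').eval T := by
  choose R hR using fun (i : ℕ) (c c' : Idx S) => exists_integral_eval
    (derivative^[i] (X ^ expo c : ℝ[X]) * derivative^[i] (X ^ expo c' : ℝ[X]))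
  refine ⟨R, fun d T => ?_⟩
  have hii : ∀ Q : ℝ[X], IntervalIntegrable (fun t => Q.eval t) MeasureTheory.volume 0 T :=
    fun Q => Q.continuous.intervalIntegrable _ _
  have hint : ∀ i, W.w i * ∑ a : Fin 3, ∑ c, ∑ c',
      ((mapMat S T)⁻¹ * d) c a * ((mapMat S T)⁻¹ * d) c' a * (R i c c').eval T =
      ∫ t in (0 : ℝ)..T, W.w i * ∑ a : Fin 3, ((derivative^[i] (piecePoly d T a)).eval t) ^ 2 := by
    intro i
    simp_rw [← hR, ← intervalIntegral.integral_const_mul]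
    rw [intervalIntegral.integral_const_mul]
    congr 1
    have hsq : ∀ (t : ℝ) (a : Fin 3), ((derivative^[i] (piecePoly d T a)).eval t) ^ 2 =
        ∑ c, ∑ c', ((mapMat S T)⁻¹ * d) c a * ((mapMat S T)⁻¹ * d) c' a *
          (derivative^[i] (X ^ expo c : ℝ[X]) * derivative^[i] (X ^ expo c' : ℝ[X])).eval t := by
      intro t a
      rw [piecePoly, iterate_derivative_sum_eval, sq, Finset.sum_mul_sum]
      refine Finset.sum_congr rfl fun c _ => Finset.sum_congr rfl fun c' _ => ?_
      rw [eval_mul]; ring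
    simp_rw [hsq]
    rw [intervalIntegral.integral_finsetSum]
    · refine Finset.sum_congr rfl fun a _ => ?_
      rw [intervalIntegral.integral_finsetSum]
      · refine Finset.sum_congr rfl fun c _ => ?_
        rw [intervalIntegral.integral_finsetSum]
        intro c' _
        exact (hii _).const_mul _
      · intro c _
        exact Continuous.intervalIntegrable (by fun_prop) _ _
    · intro a _
      exact Continuous.intervalIntegrable (by fun_prop) _ _
  rw [pieceCost, intervalIntegral.integral_add, intervalIntegral.integral_finsetSum]
  · congr 1
    · simp [mul_comm]
    · exact Finset.sum_congr rfl fun i _ => (hint i).symm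
  · intro i _
    exact Continuous.intervalIntegrable (by fun_prop) _ _
  · exact Continuous.intervalIntegrable (by fun_prop) _ _
  · exact Continuous.intervalIntegrable (by fun_prop) _ _

/-- `g` agrees on `U` with a quotient of polynomials whose denominator has no zero in `U`. -/
def IsRatOn {σ : Type*} (U : Set (σ → ℝ)) (g : (σ → ℝ) → ℝ) : Prop :=
  ∃ p q : MvPolynomial σ ℝ, ∀ x ∈ U, MvPolynomial.eval x q ≠ 0 ∧ g x = quot p q x

namespace IsRatOn

variable {σ : Type*} {U : Set (σ → ℝ)} {g h : (σ → ℝ) → ℝ}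

theorem const (c : ℝ) : IsRatOn U fun _ => c :=
  ⟨MvPolynomial.C c, 1, fun x _ => by simp [quot]⟩

theorem coord (i : σ) : IsRatOn U fun x => x i :=
  ⟨MvPolynomial.X i, 1, fun x _ => by simp [quot]⟩

theorem add (hg : IsRatOn U g) (hh : IsRatOn U h) : IsRatOn U fun x => g x + h x := by
  obtain ⟨p, q, H⟩ := hg
  obtain ⟨p', q', H'⟩ := hh
  refine ⟨p * q' + q * p', q * q', fun x hx => ⟨?_, ?_⟩⟩
  · simpa using ⟨(H x hx).1, (H' x hx).1⟩
  · beta_reduce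
    rw [(H x hx).2, (H' x hx).2, quot, quot, quot, div_add_div _ _ (H x hx).1 (H' x hx).1]
    simp

theorem mul (hg : IsRatOn U g) (hh : IsRatOn U h) : IsRatOn U fun x => g x * h x := by
  obtain ⟨p, q, H⟩ := hg
  obtain ⟨p', q', H'⟩ := hh
  refine ⟨p * p', q * q', fun x hx => ⟨?_, ?_⟩⟩
  · simpa using ⟨(H x hx).1, (H' x hx).1⟩
  · beta_reduce
    rw [(H x hx).2, (H' x hx).2, quot, quot, quot, div_mul_div_comm]
    simp

theorem inv (hg : IsRatOn U g) (h0 : ∀ x ∈ U, g x ≠ 0) : IsRatOn U fun x => (g x)⁻¹ := by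
  obtain ⟨p, q, H⟩ := hg
  refine ⟨q, p, fun x hx => ⟨fun hp => h0 x hx ?_, ?_⟩⟩
  · rw [(H x hx).2, quot, hp, zero_div]
  · beta_reduce
    rw [(H x hx).2, quot, quot, inv_div]

theorem sum {ι : Type*} (s : Finset ι) {f : ι → (σ → ℝ) → ℝ} (hf : ∀ i ∈ s, IsRatOn U (f i)) :
    IsRatOn U fun x => ∑ i ∈ s, f i x := by
  classical
  induction s using Finset.induction_on with
  | empty => simpa using const 0
  | insert i s hi ih =>
    simp_rw [Finset.sum_insert hi]
    exact (hf i (by simp)).add (ih fun j hj => hf j (by simp [hj]))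

theorem prod {ι : Type*} (s : Finset ι) {f : ι → (σ → ℝ) → ℝ} (hf : ∀ i ∈ s, IsRatOn U (f i)) :
    IsRatOn U fun x => ∏ i ∈ s, f i x := by
  classical
  induction s using Finset.induction_on with
  | empty => simpa using const 1
  | insert i s hi ih =>
    simp_rw [Finset.prod_insert hi]
    exact (hf i (by simp)).mul (ih fun j hj => hf j (by simp [hj]))

theorem polynomial_eval (Q : ℝ[X]) (hg : IsRatOn U g) : IsRatOn U fun x => Q.eval (g x) := by
  simp_rw [eval_eq_sum_range]
  refine sum _ fun i _ => (const _).mul ?_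
  have := prod (Finset.range i) (f := fun _ => g) fun _ _ => hg
  simpa using this

theorem det {n : Type*} [Fintype n] [DecidableEq n] {A : (σ → ℝ) → Matrix n n ℝ}
    (hA : ∀ i j, IsRatOn U fun x => A x i j) : IsRatOn U fun x => (A x).det := by
  simp_rw [Matrix.det_apply']
  exact sum _ fun s _ => (const _).mul (prod _ fun i _ => hA _ _)

/-- Cramer's rule. -/
theorem matrix_inv {n : Type*} [Fintype n] [DecidableEq n] {A : (σ → ℝ) → Matrix n n ℝ}
    (hA : ∀ i j, IsRatOn U fun x => A x i j) (h0 : ∀ x ∈ U, (A x).det ≠ 0) (i j : n) :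
    IsRatOn U fun x => (A x)⁻¹ i j := by
  simp_rw [Matrix.inv_def, Ring.inverse_eq_inv', Matrix.smul_apply, smul_eq_mul,
    Matrix.adjugate_apply]
  refine ((det hA).inv h0).mul (det fun k l => ?_)
  by_cases hk : k = j
  · subst hk; simpa using const _
  · simpa [Matrix.updateRow_ne hk] using hA k l

end IsRatOn

theorem isRatOn_cost {S M : ℕ} (W : Weights) (F : Finset (Entry S M)) (DF : {e // e ∉ F} → ℝ) :
    IsRatOn {z : {e // e ∈ F} ⊕ Fin M → ℝ | (fun m => z (Sum.inr m)) ∈ posTimes M}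
      fun z => cost W F DF (fun e => z (Sum.inl e)) fun m => z (Sum.inr m) := by
  obtain ⟨R, hR⟩ := exists_pieceCost_eq (S := S) W
  simp_rw [cost, hR]
  have hT : ∀ m, IsRatOn {z : {e // e ∈ F} ⊕ Fin M → ℝ | (fun m => z (Sum.inr m)) ∈ posTimes M}
      fun z => z (Sum.inr m) := fun m => IsRatOn.coord _
  have hc : ∀ m c a, IsRatOn
      {z : {e // e ∈ F} ⊕ Fin M → ℝ | (fun m => z (Sum.inr m)) ∈ posTimes M}
      fun z => ((mapMat S (z (Sum.inr m)))⁻¹ *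
        boundary (assemble F DF fun e => z (Sum.inl e)) m) c a := by
    intro m c a
    simp_rw [Matrix.mul_apply]
    refine IsRatOn.sum _ fun c' _ => IsRatOn.mul ?_ ?_
    · refine IsRatOn.matrix_inv (A := fun z => mapMat S (z (Sum.inr m))) ?_ ?_ c c'
      · rintro (i | i) j
        · exact IsRatOn.const _
        · exact IsRatOn.polynomial_eval _ (hT m)
      · exact fun z hz => det_mapMat_ne_zero S (hz m).ne'
    · have hD : ∀ e, IsRatOn
          {z : {e // e ∈ F} ⊕ Fin M → ℝ | (fun m => z (Sum.inr m)) ∈ posTimes M}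
          fun z => assemble F DF (fun e => z (Sum.inl e)) e := by
        intro e
        by_cases he : e ∈ F
        · simp only [assemble, he, dif_pos]
          exact IsRatOn.coord _
        · simp only [assemble, he, dif_neg, not_false_eq_true]
          exact IsRatOn.const _
      rcases c' with i | i
      · exact hD _
      · exact hD _
  refine IsRatOn.sum _ fun m _ => IsRatOn.add ((IsRatOn.const _).mul (hT m)) ?_
  refine IsRatOn.sum _ fun i _ => (IsRatOn.const _).mul (IsRatOn.sum _ fun a _ =>
    IsRatOn.sum _ fun c _ => IsRatOn.sum _ fun c' _ => ((hc m c a).mul (hc m c' a)).mul ?_)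
  exact IsRatOn.polynomial_eval _ (hT m)

end TrajAM

/-! ### The scalar recursion and the gain of one sweep -/

namespace TrajAM

/-- Induction on δ_k A_k ≤ 1, where A_k is the denominator, using (1 - cδ)(1 + cδ) ≤ 1. This product
form also covers δ = 0, where the inverse takes the value 0. -/
theorem le_one_div_of_succ_le_sub_sq {δ : ℕ → ℝ} {c : ℝ} (hc : 0 < c) {k₀ : ℕ}
    (h0 : ∀ k ≥ k₀, 0 ≤ δ k) (hstep : ∀ k ≥ k₀, δ (k + 1) ≤ δ k - c * δ k ^ 2) {k : ℕ}
    (hk : k₀ ≤ k) : δ k ≤ 1 / (c * ((k : ℝ) - k₀) + (δ k₀)⁻¹) := by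
  have hmul : δ k * (c * ((k : ℝ) - k₀) + (δ k₀)⁻¹) ≤ 1 := by
    induction k, hk using Nat.le_induction with
    | base => simpa using mul_inv_le_one
    | succ k hk ih =>
      have hk' : (0 : ℝ) ≤ (k : ℝ) - k₀ := sub_nonneg.2 (by exact_mod_cast hk)
      have hA : 0 ≤ c * ((k : ℝ) - k₀) + (δ k₀)⁻¹ :=
        add_nonneg (mul_nonneg hc.le hk') (inv_nonneg.2 (h0 k₀ le_rfl))
      set A := c * ((k : ℝ) - k₀) + (δ k₀)⁻¹
      have hA' : c * (((k + 1 : ℕ) : ℝ) - k₀) + (δ k₀)⁻¹ = A + c := by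
        push_cast; ring
      rw [hA']
      have h1 := h0 k hk
      have h2 := h0 (k + 1) (by omega)
      have h3 := hstep k hk
      rcases h1.eq_or_lt with h4 | h4
      · rw [← h4] at h3
        have : δ (k + 1) = 0 := le_antisymm (by simpa using h3) h2
        simp [this]
      -- Otherwise the recursion would make the next term negative.
      have h5 : 0 ≤ 1 - c * δ k := by
        by_contra! hneg
        have := mul_neg_of_pos_of_neg h4 hneg
        linarith [this, h2, h3, show δ k * (1 - c * δ k) = δ k - c * δ k ^ 2 by ring]
      calc δ (k + 1) * (A + c) ≤ (δ k - c * δ k ^ 2) * (A + c) := by gcongr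
        _ = (1 - c * δ k) * (δ k * A + c * δ k) := by ring
        _ ≤ (1 - c * δ k) * (1 + c * δ k) := by gcongr
        _ = 1 - (c * δ k) ^ 2 := by ring
        _ ≤ 1 := by linarith [sq_nonneg (c * δ k)]
  have hk' : (0 : ℝ) ≤ (k : ℝ) - k₀ := sub_nonneg.2 (by exact_mod_cast hk)
  have hi : 0 ≤ (δ k₀)⁻¹ := inv_nonneg.2 (h0 k₀ le_rfl)
  have hB : 0 ≤ c * ((k : ℝ) - k₀) + (δ k₀)⁻¹ := add_nonneg (mul_nonneg hc.le hk') hi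
  rcases hB.eq_or_lt with h | h
  · have h1 : c * ((k : ℝ) - k₀) = 0 := by linarith [mul_nonneg hc.le hk']
    have h2 : (δ k₀)⁻¹ = 0 := by linarith
    have h3 : (k : ℝ) = k₀ := by
      have := (mul_eq_zero.1 h1).resolve_left hc.ne'
      linarith
    have h4 : k = k₀ := by exact_mod_cast h3
    rw [← h, div_zero, h4, inv_eq_zero.1 h2]
  · exact (le_div_iff₀ h).2 hmul

theorem dist_add_single_lt {σ : Type*} [Fintype σ] [DecidableEq σ] {x a : σ → ℝ} {ε s : ℝ} {i : σ}
    (hs : |s| ≤ ε / 2) (hx : dist x a < ε / 2) : dist (x + Pi.single i s) a < ε := by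
  have h1 : dist (x + Pi.single i s) x = |s| := by
    rw [dist_eq_norm, add_sub_cancel_left, Pi.norm_single, Real.norm_eq_abs]
  linarith [dist_triangle (x + Pi.single i s) x a]

variable {ι : Type} {M : ℕ} {J : (ι → ℝ) → (Fin M → ℝ) → ℝ} {DP : ℕ → ι → ℝ} {T : ℕ → Fin M → ℝ}

theorem IsAMRun.isArgminTime (h : IsAMRun J DP T) (k : ℕ) :
    IsArgminTime (J (DP k)) (T k) := by
  cases k with
  | zero => exact h.init
  | succ k => exact h.stepT k

/-- The time step cannot undo the gain of the exact minimization over `D`, since `T k` is a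
competitor in it. -/
theorem IsAMRun.succ_le (h : IsAMRun J DP T) (k : ℕ) (D : ι → ℝ) :
    J (DP (k + 1)) (T (k + 1)) ≤ J D (T k) :=
  ((h.stepT k).2 (h.isArgminTime k).1).trans (h.stepD k (Set.mem_univ D))

theorem IsAMRun.exists_sq_le [Finite ι] (hrun : IsAMRun J DP T)
    (hJ : IsRatOn {z : ι ⊕ Fin M → ℝ | (fun m => z (Sum.inr m)) ∈ posTimes M}
      fun z => J (fun e => z (Sum.inl e)) fun m => z (Sum.inr m))
    {Dhat : ι → ℝ} {That : Fin M → ℝ} (hThat : That ∈ posTimes M)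
    (hconv : Tendsto (fun k => (DP k, T k)) atTop (𝓝 (Dhat, That))) :
    ∃ C > 0, ∀ᶠ k in atTop, (J (DP k) (T k) - J Dhat That) ^ 2 ≤
      C * (J (DP k) (T k) - J (DP (k + 1)) (T (k + 1))) := by
  classical
  obtain ⟨p, q, hpq⟩ := hJ
  have := Fintype.ofFinite ι
  set U := {z : ι ⊕ Fin M → ℝ | (fun m => z (Sum.inr m)) ∈ posTimes M} with hU
  let a : ι ⊕ Fin M → ℝ := Sum.elim Dhat That
  let z : ℕ → ι ⊕ Fin M → ℝ := fun k => Sum.elim (DP k) (T k)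
  have haU : a ∈ U := hThat
  have hzU : ∀ k, z k ∈ U := fun k => (hrun.isArgminTime k).1
  have hza : Tendsto z atTop (𝓝 a) := by
    rw [nhds_prod_eq, tendsto_prod_iff'] at hconv
    rw [tendsto_pi_nhds]
    rintro (e | m)
    · exact tendsto_pi_nhds.1 hconv.1 e
    · exact tendsto_pi_nhds.1 hconv.2 m
  have hUnhds : ∀ᶠ x in 𝓝 a, x ∈ U := by
    have : ∀ᶠ x in 𝓝 a, ∀ m : Fin M, 0 < x (Sum.inr m) := eventually_all.2 fun m =>
      (continuous_apply (Sum.inr m)).continuousAt.eventually_const_lt (hThat m)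
    exact this
  obtain ⟨ε, hε, hball⟩ := Metric.eventually_nhds_iff.1 hUnhds
  -- Moves of length ε/2 from iterates within ε/2 of the limit stay in the ε-ball of positive times.
  obtain ⟨C, hC, hloc⟩ := exists_sq_quot_sub_le (p := p) (hpq a haU).1 (half_pos hε)
  refine ⟨C, hC, ?_⟩
  filter_upwards [hza.eventually hloc, hza.eventually (Metric.ball_mem_nhds a (half_pos hε))]
    with k hk hdist
  have hcost : ∀ k, J (DP k) (T k) = quot p q (z k) := fun k => (hpq (z k) (hzU k)).2
  have hcosta : J Dhat That = quot p q a := (hpq a haU).2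
  rw [hcosta, hcost k]
  have hdec := hrun.succ_le k (DP k)
  refine hk _ (by rw [← hcost k]; exact sub_nonneg.2 hdec) ?_
  intro i s hs
  rw [sub_sub_cancel]
  have hxU : z k + Pi.single i s ∈ U := by
    exact hball (dist_add_single_lt hs hdist)
  rw [← (hpq _ hxU).2]
  beta_reduce
  -- A move in `D` competes in the next `D`-step. A move in time cannot beat `T k`, already optimal
  -- for `DP k`, and the sweep does not increase J.
  rcases i with e | m
  · have hT : (fun m => (z k + Pi.single (Sum.inl e) s : ι ⊕ Fin M → ℝ) (Sum.inr m)) = T k := by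
      funext m; simp [z]
    rw [hT]
    exact hrun.succ_le k _
  · have hD : (fun e => (z k + Pi.single (Sum.inr m) s : ι ⊕ Fin M → ℝ) (Sum.inl e)) = DP k := by
      funext e; simp [z]
    rw [hD]
    exact hdec.trans ((hrun.isArgminTime k).2 hxU)

end TrajAM

/-! ### The convergence rate -/

theorem theorem2 (S M : ℕ) (hS : 1 ≤ S) (hM : 1 ≤ M) (W : TrajAM.Weights)
    (F : Finset (TrajAM.Entry S M)) (DF : {e // e ∉ F} → ℝ)
    (DP : ℕ → {e // e ∈ F} → ℝ) (T : ℕ → Fin M → ℝ)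
    (hrun : TrajAM.IsAMRun (TrajAM.cost W F DF) DP T)
    (Dhat : {e // e ∈ F} → ℝ) (That : Fin M → ℝ)
    (hmin : TrajAM.IsStrictLocalMin (TrajAM.cost W F DF) Dhat That)
    (hconv : Tendsto (fun k => (DP k, T k)) atTop (𝓝 (Dhat, That))) :
    (∃ Kc : ℕ, 0 < Kc ∧ ∃ γ : ℝ, 0 < γ ∧ ∀ K : ℕ, Kc ≤ K →
      TrajAM.cost W F DF (DP K) (T K) - TrajAM.cost W F DF Dhat That
          ≤ 1 / (γ * ((K : ℝ) - (Kc : ℝ)) +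
              (TrajAM.cost W F DF (DP Kc) (T Kc) - TrajAM.cost W F DF Dhat That)⁻¹) ∧
      -- the bound reads `0` if the minimal value is already attained at iteration `Kc`
      (TrajAM.cost W F DF (DP Kc) (T Kc) = TrajAM.cost W F DF Dhat That →
        TrajAM.cost W F DF (DP K) (T K) = TrajAM.cost W F DF Dhat That)) ∧
    (fun K : ℕ => TrajAM.cost W F DF (DP K) (T K) - TrajAM.cost W F DF Dhat That)
      =O[atTop] (fun K : ℕ => 1 / (K : ℝ)) := by
  obtain ⟨hThat, hloc⟩ := hmin
  obtain ⟨C, hC, hsq⟩ := hrun.exists_sq_le (TrajAM.isRatOn_cost W F DF) hThat hconv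
  set δ : ℕ → ℝ := fun k =>
    TrajAM.cost W F DF (DP k) (T k) - TrajAM.cost W F DF Dhat That with hδ
  have hnonneg : ∀ᶠ k in atTop, 0 ≤ δ k := by
    filter_upwards [hconv.eventually hloc] with k hk
    by_cases h : (DP k, T k) = (Dhat, That)
    · have h1 : DP k = Dhat := congrArg Prod.fst h
      have h2 : T k = That := congrArg Prod.snd h
      simp [hδ, h1, h2]
    · exact sub_nonneg.2 (hk h).le
  obtain ⟨k₀, hk₀⟩ := eventually_atTop.1 (hsq.and hnonneg)
  have h0 : ∀ k ≥ k₀ + 1, 0 ≤ δ k := fun k hk => (hk₀ k (by omega)).2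
  have hstep : ∀ k ≥ k₀ + 1, δ (k + 1) ≤ δ k - 1 / C * δ k ^ 2 := by
    intro k hk
    have h1 : δ k ^ 2 ≤ C * (δ k - δ (k + 1)) := by
      have := (hk₀ k (by omega)).1
      simpa only [hδ, sub_sub_sub_cancel_right] using this
    have h2 : 1 / C * δ k ^ 2 ≤ δ k - δ (k + 1) := by
      rw [one_div_mul_eq_div, div_le_iff₀ hC, mul_comm]
      exact h1
    linarith
  have hγ : 0 < 1 / C := one_div_pos.2 hC
  have hbound : ∀ K, k₀ + 1 ≤ K →
      δ K ≤ 1 / (1 / C * ((K : ℝ) - ((k₀ + 1 : ℕ) : ℝ)) + (δ (k₀ + 1))⁻¹) := fun K hK =>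
    TrajAM.le_one_div_of_succ_le_sub_sq hγ h0 hstep hK
  refine ⟨⟨k₀ + 1, Nat.succ_pos _, 1 / C, hγ, fun K hK => ⟨hbound K hK, fun h => ?_⟩⟩, ?_⟩
  · have hz : δ K = 0 := by
      induction K, hK using Nat.le_induction with
      | base => exact sub_eq_zero.2 h
      | succ K hK ih =>
        have := hstep K hK
        rw [ih] at this
        exact le_antisymm (by simpa using this) (h0 _ (by omega))
    exact sub_eq_zero.1 hz
  -- For K ≥ 2 Kc one has K - Kc ≥ K/2, so with γ = 1/C the bound is at most 2C/K.
  · refine Asymptotics.IsBigO.of_bound (2 * C) ?_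
    filter_upwards [eventually_ge_atTop (2 * (k₀ + 1))] with K hK
    have hK' : (2 : ℝ) * ((k₀ + 1 : ℕ) : ℝ) ≤ K := by exact_mod_cast hK
    have hKpos : (0 : ℝ) < K := by
      have : 0 < K := by omega
      exact_mod_cast this
    have hi : 0 ≤ (δ (k₀ + 1))⁻¹ := inv_nonneg.2 (h0 _ le_rfl)
    rw [Real.norm_of_nonneg (h0 K (by omega)), Real.norm_of_nonneg (by positivity)]
    refine (hbound K (by omega)).trans ?_
    have h1 : 1 / C * ((K : ℝ) / 2) ≤
        1 / C * ((K : ℝ) - ((k₀ + 1 : ℕ) : ℝ)) + (δ (k₀ + 1))⁻¹ := by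
      have : 1 / C * ((K : ℝ) / 2) ≤ 1 / C * ((K : ℝ) - ((k₀ + 1 : ℕ) : ℝ)) := by
        gcongr; linarith
      linarith
    refine (one_div_le_one_div_of_le (by positivity) h1).trans_eq ?_
    field_simp
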